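/- Let $f,g:[0,1]\to[0,1]$ be the piecewise linear maps $$f(x)=\begin{cases}3x,&x\in[0,\tfrac13],\\ -x+\tfrac43,&x\in(\tfrac13,\tfrac23),\\ x,&x\in[\tfrac23,1],\end{cases}\qquad g(x)=\begin{cases}x,&x\in[0,\tfrac13],\\ -x+\tfrac23,&x\in(\tfrac13,\tfrac23),\\ 3x-2,&x\in[\tfrac23,1].\end{cases}$$ For $p\in[0,1]$ consider the random dynamical system in which $x_{n+1}=f(x_n)$ with probability $p$ and $x_{n+1}=g(x_n)$ with probability $1-p$, the choices at different times being independent, and let $P$ be the law of the sequence of choices. For $x,y\in[0,1]$ let $x_n$, $y_n$ be the trajectories of $x_0=x$, $y_0=y$ driven by the same sequence of choices, and put $$F^{(n)}_{xy}(t)=\frac1n\sum_{i=0}^{n-1}P(|x_i-y_i|<t),\quad F_{xy}(t)=\liminf_{n\to\infty}F^{(n)}_{xy}(t),\quad F^{\star}_{xy}(t)=\limsup_{n\to\infty}F^{(n)}_{xy}(t),$$ $$\mu(f,g,p)=\sup_{x,y\in[0,1]}\int_0^1\bigl(F^{\star}_{xy}(t)-F_{xy}(t)\bigr)\,dt .$$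 A single map $h:[0,1]\to[0,1]$ is called distributionally chaotic if there are $x,y\in[0,1]$ and a nonempty open interval $(c,d)$ such that, with $\Phi_n(t)=\frac1n\#\{0\le i<n:|h^i(x)-h^i(y)|<t\}$, one has $\liminf_{n}\Phi_n(t)<\limsup_{n}\Phi_n(t)$ for all $t\in(c,d)$. Then: 1. $\mu(f,g,p)=1$ for every $p\in(0,1)$. 2. For each of the maps $f$ and $g$ taken alone, every trajectory converges to a fixed point of that map, and the map is not distributionally chaotic. 3. $\mu(f,g,0)=\mu(f,g,1)=0$. -/

import Mathlib

open Set Filter Topology MeasureTheory ProbabilityTheory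

noncomputable section

namespace RandomChaos

/-- The law of an infinite sequence of independent choices, each equal to `true` (apply `f`) with
probability `p` and to `false` (apply `g`) with probability `1 - p`: the product measure on
`ℕ → Bool`. -/
def choiceMeasure (p : unitInterval) : Measure (ℕ → Bool) :=
  Measure.infinitePi (fun _ : ℕ => bernoulliMeasure true false p)

/-- The trajectory of `x` along the sequence of choices `ω`: `x₀ = x`, and `xₙ₊₁` is `f xₙ` or
`g xₙ` according to the choice `ω n` (so `ω n` is the map used in step `n + 1`). -/
def trajectory {X : Type*} (f g : X → X) (ω : ℕ → Bool) (x : X) : ℕ → X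
  | 0 => x
  | n + 1 => if ω n then f (trajectory f g ω x n) else g (trajectory f g ω x n)

variable {a b : ℝ}

/-- `F_{xy}^{(n)}(t) = (1/n) ∑_{i < n} P(|x_i - y_i| < t)` for the random system generated by
`f` and `g` on `[a, b]`. -/
def distFun (f g : Icc a b → Icc a b) (p : unitInterval) (x y : Icc a b) (n : ℕ) (t : ℝ) : ℝ :=
  (1 / (n : ℝ)) * ∑ i ∈ Finset.range n, (choiceMeasure p).real
    {ω | |((trajectory f g ω x i : Icc a b) : ℝ) - ((trajectory f g ω y i : Icc a b) : ℝ)| < t}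

/-- The lower distribution function `F_{xy}`. -/
def lowerDistFun (f g : Icc a b → Icc a b) (p : unitInterval) (x y : Icc a b) (t : ℝ) : ℝ :=
  liminf (fun n : ℕ => distFun f g p x y n t) atTop

/-- The upper distribution function `F_{xy}^*`. -/
def upperDistFun (f g : Icc a b → Icc a b) (p : unitInterval) (x y : Icc a b) (t : ℝ) : ℝ :=
  limsup (fun n : ℕ => distFun f g p x y n t) atTop

/-- The measure of distributional chaos `μ(f, g, p)` of the random system on `I = [a, b]`:
the supremum over `x, y ∈ I` of `(1/|I|) ∫_0^{|I|} (F_{xy}^*(t) - F_{xy}(t)) dt`. -/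
def chaosMeasure (f g : Icc a b → Icc a b) (p : unitInterval) : ℝ :=
  ⨆ q : Icc a b × Icc a b, (1 / (b - a)) *
    ∫ t in (0 : ℝ)..(b - a), (upperDistFun f g p q.1 q.2 t - lowerDistFun f g p q.1 q.2 t)

open Classical in
/-- The deterministic `F_{xy}^{(n)}(t) = (1/n) #{i < n : |f^i(x) - f^i(y)| < t}` of one map. -/
def detDistFun (f : Icc a b → Icc a b) (x y : Icc a b) (n : ℕ) (t : ℝ) : ℝ :=
  (1 / (n : ℝ)) *
    (((Finset.range n).filter (fun i => |((f^[i] x : Icc a b) : ℝ) - ((f^[i] y : Icc a b) : ℝ)| < t)).card : ℝ)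

/-- A single interval map is distributionally chaotic if for some `x, y` the lower distribution
function is strictly below the upper one throughout some nondegenerate open interval. -/
def IsDistributionallyChaotic (f : Icc a b → Icc a b) : Prop :=
  ∃ x y : Icc a b, ∃ c d : ℝ, c < d ∧ ∀ t ∈ Ioo c d,
    liminf (fun n : ℕ => detDistFun f x y n t) atTop <
      limsup (fun n : ℕ => detDistFun f x y n t) atTop

/-- Every trajectory of `f` converges to a fixed point of `f`. -/
def AllTrajectoriesConverge (f : Icc a b → Icc a b) : Prop :=
  ∀ x : Icc a b, ∃ z : Icc a b, f z = z ∧ Tendsto (fun n : ℕ => f^[n] x) atTop (𝓝 z)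

/-- The map `f` on `[0, 1]`: `3x` on `[0, 1/3]`, `-x + 4/3` on `(1/3, 2/3)`, `x` on
`[2/3, 1]`. -/
def mapF (x : Icc (0 : ℝ) 1) : Icc (0 : ℝ) 1 :=
  ⟨if (x : ℝ) ≤ 1 / 3 then 3 * x else if (x : ℝ) < 2 / 3 then -x + 4 / 3 else x, by
    obtain ⟨x, h0, h1⟩ := x
    dsimp only
    split_ifs <;> constructor <;> linarith⟩

/-- The map `g` on `[0, 1]`: `x` on `[0, 1/3]`, `-x + 2/3` on `(1/3, 2/3)`, `3x - 2` on
`[2/3, 1]`. -/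
def mapG (x : Icc (0 : ℝ) 1) : Icc (0 : ℝ) 1 :=
  ⟨if (x : ℝ) ≤ 1 / 3 then x else if (x : ℝ) < 2 / 3 then -x + 2 / 3 else 3 * x - 2, by
    obtain ⟨x, h0, h1⟩ := x
    dsimp only
    split_ifs <;> constructor <;> linarith⟩

end RandomChaos

end

/-! For $0<p<1$ the second point is taken to be $0$. It is fixed by both maps, so the distance at
time $n$ is $x_n$ itself, and the expectation $E x_n$ is an iterate of the transition operator. Let
$T$ be the three-branch map $3x$, $2-3x$, $3x-2$. Conditioning on the first choice shows that $E
x_n$ converges to $L$ from $x$ whenever it does so from $T(x)$: on an outer third one map stays put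
and the other applies $T$, while from the middle third both maps land in outer thirds with the same
image $T(x)$ (`tendsto_expectedPos_of_middle`). Backward orbits of $T$ are dense, and $0$ and $1$
are both common fixed points, so each limit $0$ and $1$ occurs on a dense set. By Baire, some $x$
has time averages of $E x_n$ that return arbitrarily close to both $0$ and $1$
(`exists_oscillating_meanPos`). Markov's inequality then gives $F^\star=1$ and $F=0$ on $(0,1)$. For
a single map, convergent trajectories have convergent distances, so the distribution functions
converge at all but one $t$. -/

namespace RandomChaos

/-! ### Transition operator and the law of a trajectory -/

section Operator

variable {X : Type*}

/-- The transition operator of the random system: apply `f` with probability `p` and `g` with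
probability `1 - p`. -/
def choiceOp (f g : X → X) (p : ℝ) (h : X → ℝ) (x : X) : ℝ :=
  p * h (f x) + (1 - p) * h (g x)

theorem choiceOp_iterate_succ (f g : X → X) (p : ℝ) (h : X → ℝ) (n : ℕ) (x : X) :
    (choiceOp f g p)^[n + 1] h x =
      p * (choiceOp f g p)^[n] h (f x) + (1 - p) * (choiceOp f g p)^[n] h (g x) := by
  rw [Function.iterate_succ_apply']
  rfl

theorem choiceOp_iterate_linear (f g : X → X) (p : ℝ) (r s : ℝ) (h k : X → ℝ) (n : ℕ) (x : X) :
    (choiceOp f g p)^[n] (fun z => r * h z + s * k z) x =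
      r * (choiceOp f g p)^[n] h x + s * (choiceOp f g p)^[n] k x := by
  induction n generalizing x with
  | zero => rfl
  | succ n ih => simp only [choiceOp_iterate_succ, ih]; ring

theorem choiceOp_iterate_const (f g : X → X) (p : ℝ) (r : ℝ) (n : ℕ) (x : X) :
    (choiceOp f g p)^[n] (fun _ => r) x = r := by
  induction n generalizing x with
  | zero => rfl
  | succ n ih => simp only [choiceOp_iterate_succ, ih]; ring

theorem choiceOp_iterate_mono (f g : X → X) {p : ℝ} (hp : 0 ≤ p) (hp' : p ≤ 1) {h k : X → ℝ}
    (hk : ∀ x, h x ≤ k x) (n : ℕ) (x : X) :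
    (choiceOp f g p)^[n] h x ≤ (choiceOp f g p)^[n] k x := by
  induction n generalizing x with
  | zero => exact hk x
  | succ n ih =>
    simp only [choiceOp_iterate_succ]
    have := ih (f x)
    have := ih (g x)
    have := sub_nonneg.2 hp'
    gcongr

theorem continuous_choiceOp_iterate [TopologicalSpace X] {f g : X → X} (hf : Continuous f)
    (hg : Continuous g) (p : ℝ) {h : X → ℝ} (hh : Continuous h) (n : ℕ) :
    Continuous ((choiceOp f g p)^[n] h) := by
  induction n with
  | zero => exact hh
  | succ n ih =>
    rw [Function.iterate_succ_apply']
    exact (continuous_const.mul (ih.comp hf)).add (continuous_const.mul (ih.comp hg))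

theorem setOf_trajectory_succ (f g : X → X) (x : X) (n : ℕ) (A : Set X) :
    {ω | trajectory f g ω x (n + 1) ∈ A} =
      ((fun ω : ℕ → Bool => ω n) ⁻¹' {true} ∩ {ω | trajectory f g ω x n ∈ f ⁻¹' A}) ∪
      ((fun ω : ℕ → Bool => ω n) ⁻¹' {false} ∩ {ω | trajectory f g ω x n ∈ g ⁻¹' A}) := by
  ext ω
  cases h : ω n <;> simp [trajectory, h]

/-- The position at time $n$ depends only on choices before $n$; this makes it independent of choice
$n$. -/
theorem measurableSet_iSup_trajectory (f g : X → X) (x : X) (n : ℕ) (A : Set X) :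
    MeasurableSet[⨆ i ∈ Iio n, MeasurableSpace.comap (fun ω : ℕ → Bool => ω i) inferInstance]
      {ω | trajectory f g ω x n ∈ A} := by
  induction n generalizing A with
  | zero => exact @MeasurableSet.const _ (_) (x ∈ A)
  | succ n ih =>
    set m : ℕ → MeasurableSpace (ℕ → Bool) := fun i =>
      MeasurableSpace.comap (fun ω : ℕ → Bool => ω i) inferInstance
    have hle : ⨆ i ∈ Iio n, m i ≤ ⨆ i ∈ Iio (n + 1), m i :=
      biSup_mono fun i (hi : i < n) => hi.trans n.lt_succ_self
    have hle' : m n ≤ ⨆ i ∈ Iio (n + 1), m i := le_biSup m (show n ∈ Iio (n + 1) from n.lt_succ_self)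
    have key (B : Set X) : MeasurableSet[⨆ i ∈ Iio (n + 1), m i]
        {ω | trajectory f g ω x n ∈ B} := hle _ (ih B)
    have key' (b : Bool) : MeasurableSet[⨆ i ∈ Iio (n + 1), m i]
        ((fun ω : ℕ → Bool => ω n) ⁻¹' {b}) := hle' _ ⟨{b}, trivial, rfl⟩
    rw [setOf_trajectory_succ]
    exact @MeasurableSet.union _ (_) _ _ (@MeasurableSet.inter _ (_) _ _ (key' true) (key _))
      (@MeasurableSet.inter _ (_) _ _ (key' false) (key _))

theorem comap_eval_le (i : ℕ) :
    MeasurableSpace.comap (fun ω : ℕ → Bool => ω i) inferInstance ≤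
      (inferInstance : MeasurableSpace (ℕ → Bool)) :=
  (measurable_pi_apply i).comap_le

theorem measurableSet_trajectory (f g : X → X) (x : X) (n : ℕ) (A : Set X) :
    MeasurableSet {ω | trajectory f g ω x n ∈ A} :=
  (iSup₂_le fun i _ => comap_eval_le i : (⨆ i ∈ Iio n, _) ≤ _) _
    (measurableSet_iSup_trajectory f g x n A)

instance (p : unitInterval) : IsProbabilityMeasure (choiceMeasure p) := by
  unfold choiceMeasure; infer_instance

theorem choiceMeasure_real_inter_trajectory (f g : X → X) (p : unitInterval) (x : X) (n : ℕ)
    (b : Bool) (A : Set X) :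
    (choiceMeasure p).real ((fun ω : ℕ → Bool => ω n) ⁻¹' {b} ∩ {ω | trajectory f g ω x n ∈ A}) =
      (bernoulliMeasure true false p).real {b} *
        (choiceMeasure p).real {ω | trajectory f g ω x n ∈ A} := by
  have hind : iIndepFun (fun (i : ℕ) (ω : ℕ → Bool) => ω i) (choiceMeasure p) :=
    iIndepFun_infinitePi (P := fun _ : ℕ => bernoulliMeasure true false p)
      (X := fun _ b => b) (fun _ => measurable_id)
  have h := (Indep_iff _ _ _).1 (indep_iSup_of_disjoint (S := {n}) (T := Iio n) comap_eval_le
    hind.iIndep (by simp)) ((fun ω : ℕ → Bool => ω n) ⁻¹' {b}) {ω | trajectory f g ω x n ∈ A}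
      (by rw [iSup_singleton]; exact ⟨{b}, trivial, rfl⟩)
      (measurableSet_iSup_trajectory f g x n A)
  have h2 : choiceMeasure p ((fun ω : ℕ → Bool => ω n) ⁻¹' {b}) =
      bernoulliMeasure true false p {b} :=
    (measurePreserving_eval_infinitePi (fun _ : ℕ => bernoulliMeasure true false p)
      n).measure_preimage (MeasurableSet.singleton b).nullMeasurableSet
  rw [measureReal_def, h, h2, ENNReal.toReal_mul]
  rfl

-- Splitting on the last choice turns the indicator of $A$ into a mixture of the indicators of its
-- two preimages, which is one application of the operator.
open Classical in
theorem choiceMeasure_real_trajectory (f g : X → X) (p : unitInterval) (x : X) (n : ℕ)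
    (A : Set X) :
    (choiceMeasure p).real {ω | trajectory f g ω x n ∈ A} =
      (choiceOp f g p)^[n] (fun z => if z ∈ A then 1 else 0) x := by
  induction n generalizing A with
  | zero => by_cases h : x ∈ A <;> simp [trajectory, h]
  | succ n ih =>
    rw [setOf_trajectory_succ, measureReal_union, choiceMeasure_real_inter_trajectory,
      choiceMeasure_real_inter_trajectory, ih, ih, Function.iterate_succ_apply]
    · rw [bernoulliMeasure_real_apply_of_mem_of_notMem _ (by simp) (by simp) (by simp),
        bernoulliMeasure_real_apply_of_notMem_of_mem _ (by simp) (by simp) (by simp)]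
      exact (choiceOp_iterate_linear f g p _ _ _ _ n x).symm
    · refine Disjoint.inter_left _ (Disjoint.inter_right _ ?_)
      exact Disjoint.preimage _ (by simp)
    · exact ((measurable_pi_apply n) (MeasurableSet.singleton false)).inter
        (measurableSet_trajectory f g x n _)

theorem trajectory_of_fixed {f g : X → X} {x : X} (hf : f x = x) (hg : g x = x) (ω : ℕ → Bool)
    (n : ℕ) : trajectory f g ω x n = x := by
  induction n with
  | zero => rfl
  | succ n ih => simp [trajectory, ih, hf, hg]

theorem trajectory_const_true (f g : X → X) (x : X) (n : ℕ) :
    trajectory f g (fun _ => true) x n = f^[n] x := by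
  induction n with
  | zero => rfl
  | succ n ih => simp [trajectory, ih, Function.iterate_succ_apply']

theorem trajectory_const_false (f g : X → X) (x : X) (n : ℕ) :
    trajectory f g (fun _ => false) x n = g^[n] x := by
  induction n with
  | zero => rfl
  | succ n ih => simp [trajectory, ih, Function.iterate_succ_apply']

end Operator

/-! ### Degenerate probabilities and single maps -/

section Deterministic

variable {a b : ℝ}

theorem choiceMeasure_zero : choiceMeasure 0 = Measure.dirac (fun _ => false) := by
  simp [choiceMeasure, Measure.infinitePi_dirac]

theorem choiceMeasure_one : choiceMeasure 1 = Measure.dirac (fun _ => true) := by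
  simp [choiceMeasure, Measure.infinitePi_dirac]

theorem distFun_zero (f g : Icc a b → Icc a b) (x y : Icc a b) :
    distFun f g 0 x y = detDistFun g x y := by
  classical
  ext n t
  rw [distFun, detDistFun, choiceMeasure_zero, Finset.card_filter, Nat.cast_sum]
  congr 1
  refine Finset.sum_congr rfl fun i _ => ?_
  rw [measureReal_def, Measure.dirac_apply]
  simp [indicator, trajectory_const_false, apply_ite ENNReal.toReal]

theorem distFun_one (f g : Icc a b → Icc a b) (x y : Icc a b) :
    distFun f g 1 x y = detDistFun f x y := by
  classical
  ext n t
  rw [distFun, detDistFun, choiceMeasure_one, Finset.card_filter, Nat.cast_sum]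
  congr 1
  refine Finset.sum_congr rfl fun i _ => ?_
  rw [measureReal_def, Measure.dirac_apply]
  simp [indicator, trajectory_const_true, apply_ite ENNReal.toReal]

/-- If the distance of two trajectories converges to `d`, the distribution functions converge
at every `t ≠ d`. -/
theorem exists_tendsto_detDistFun {f : Icc a b → Icc a b} (hf : AllTrajectoriesConverge f)
    (x y : Icc a b) :
    ∃ d : ℝ, ∀ t ≠ d, ∃ L : ℝ, Tendsto (fun n => detDistFun f x y n t) atTop (𝓝 L) := by
  classical
  obtain ⟨u, -, hu⟩ := hf x
  obtain ⟨v, -, hv⟩ := hf y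
  have hd : Tendsto (fun n => |((f^[n] x : Icc a b) : ℝ) - ((f^[n] y : Icc a b) : ℝ)|) atTop
      (𝓝 |(u : ℝ) - v|) :=
    (((continuous_subtype_val.tendsto u).comp hu).sub
      ((continuous_subtype_val.tendsto v).comp hv)).abs
  refine ⟨|(u : ℝ) - v|, fun t ht => ?_⟩
  obtain ⟨L, hL⟩ : ∃ L : ℝ, Tendsto (fun n : ℕ =>
      if |((f^[n] x : Icc a b) : ℝ) - ((f^[n] y : Icc a b) : ℝ)| < t then (1 : ℝ) else 0) atTop
      (𝓝 L) := by
    rcases lt_or_gt_of_ne ht with h | h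
    · refine ⟨0, tendsto_const_nhds.congr' ?_⟩
      filter_upwards [hd.eventually (lt_mem_nhds h)] with n hn
      rw [if_neg hn.le.not_gt]
    · refine ⟨1, tendsto_const_nhds.congr' ?_⟩
      filter_upwards [hd.eventually (gt_mem_nhds h)] with n hn
      rw [if_pos hn]
  refine ⟨L, hL.cesaro.congr fun n => ?_⟩
  rw [detDistFun, Finset.card_filter, Nat.cast_sum, one_div]
  simp

theorem AllTrajectoriesConverge.not_isDistributionallyChaotic {f : Icc a b → Icc a b}
    (hf : AllTrajectoriesConverge f) : ¬ IsDistributionallyChaotic f := by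
  rintro ⟨x, y, c, d, hcd, h⟩
  obtain ⟨e, he⟩ := exists_tendsto_detDistFun hf x y
  obtain ⟨t, ht, hte⟩ : ∃ t ∈ Ioo c d, t ≠ e :=
    ((Ioo_infinite hcd).sdiff (finite_singleton e)).nonempty.imp fun t ht => ht
  obtain ⟨L, hL⟩ := he t hte
  exact (h t ht).ne (hL.liminf_eq.trans hL.limsup_eq.symm)

theorem AllTrajectoriesConverge.integral_eq_zero {f : Icc a b → Icc a b}
    (hf : AllTrajectoriesConverge f) (x y : Icc a b) (r s : ℝ) :
    ∫ t in r..s, (limsup (fun n => detDistFun f x y n t) atTop -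
      liminf (fun n => detDistFun f x y n t) atTop) = 0 := by
  obtain ⟨e, he⟩ := exists_tendsto_detDistFun hf x y
  refine intervalIntegral.integral_zero_ae ?_
  filter_upwards [compl_mem_ae_iff.2 (measure_singleton (μ := volume) e)] with t ht _
  obtain ⟨L, hL⟩ := he t ht
  rw [hL.liminf_eq, hL.limsup_eq, sub_self]

theorem AllTrajectoriesConverge.chaosMeasure_one {f : Icc a b → Icc a b}
    (hf : AllTrajectoriesConverge f) (g : Icc a b → Icc a b) : chaosMeasure f g 1 = 0 := by
  simp [chaosMeasure, upperDistFun, lowerDistFun, distFun_one, hf.integral_eq_zero]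

theorem AllTrajectoriesConverge.chaosMeasure_zero {g : Icc a b → Icc a b}
    (hg : AllTrajectoriesConverge g) (f : Icc a b → Icc a b) : chaosMeasure f g 0 = 0 := by
  simp [chaosMeasure, upperDistFun, lowerDistFun, distFun_zero, hg.integral_eq_zero]

end Deterministic

end RandomChaos

/-! ### The two maps and their individual dynamics -/

namespace RandomChaos

theorem coe_mapF (x : Icc (0 : ℝ) 1) : (mapF x : ℝ) =
    if (x : ℝ) ≤ 1 / 3 then 3 * (x : ℝ) else if (x : ℝ) < 2 / 3 then -x + 4 / 3 else x := rfl

theorem coe_mapG (x : Icc (0 : ℝ) 1) : (mapG x : ℝ) =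
    if (x : ℝ) ≤ 1 / 3 then (x : ℝ) else if (x : ℝ) < 2 / 3 then -x + 2 / 3 else 3 * x - 2 := rfl

/-- The reflection $x\mapsto 1-x$ conjugates the two maps, so facts about one transfer to the other.
-/
theorem mapF_symm (x : Icc (0 : ℝ) 1) :
    mapF (unitInterval.symm x) = unitInterval.symm (mapG x) := by
  apply Subtype.ext
  rw [coe_mapF, unitInterval.coe_symm_eq, unitInterval.coe_symm_eq, coe_mapG]
  split_ifs <;> linarith

theorem continuous_mapF : Continuous mapF := by
  have h : ∀ x : Icc (0 : ℝ) 1, (mapF x : ℝ) = min (3 * (x : ℝ)) (max (-x + 4 / 3) x) := by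
    intro x
    rw [coe_mapF]
    split_ifs with h1 h2
    · rw [min_eq_left]; exact le_max_of_le_left (by linarith)
    · rw [max_eq_left (by linarith), min_eq_right (by linarith)]
    · rw [max_eq_right (by linarith), min_eq_right (by linarith)]
  refine continuous_induced_rng.2 ?_
  rw [show (Subtype.val ∘ mapF) = _ from funext h]
  fun_prop

theorem continuous_mapG : Continuous mapG := by
  have h : mapG = unitInterval.symm ∘ mapF ∘ unitInterval.symm := by
    ext x; simp [mapF_symm]
  rw [h]
  exact unitInterval.continuous_symm.comp (continuous_mapF.comp unitInterval.continuous_symm)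

theorem mapF_of_two_thirds_le {x : Icc (0 : ℝ) 1} (h : 2 / 3 ≤ (x : ℝ)) : mapF x = x := by
  apply Subtype.ext
  rw [coe_mapF, if_neg (by linarith), if_neg (by linarith)]

theorem exists_iterate_mapF_ge (k : ℕ) (x : Icc (0 : ℝ) 1) (hx : 1 / 3 ≤ 3 ^ k * (x : ℝ)) :
    ∃ n, 2 / 3 ≤ ((mapF^[n] x : Icc (0 : ℝ) 1) : ℝ) := by
  induction k generalizing x with
  | zero =>
    refine ⟨1, ?_⟩
    rw [Function.iterate_one, coe_mapF]
    split_ifs <;> linarith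
  | succ k ih =>
    by_cases h : 1 / 3 ≤ 3 ^ k * (mapF x : ℝ)
    · obtain ⟨n, hn⟩ := ih (mapF x) h
      exact ⟨n + 1, hn⟩
    -- Failure of the bound forces $x>1/3$, and such points enter $[2/3,1]$ in one step.
    · refine ⟨1, ?_⟩
      have h3 : (1 : ℝ) ≤ 3 ^ k := one_le_pow₀ (by norm_num)
      rw [Function.iterate_one]
      rw [coe_mapF] at h ⊢
      split_ifs at h ⊢ with h1 h2
      · exact absurd (by rw [pow_succ] at hx; linarith) h
      · linarith
      · linarith

theorem allTrajectoriesConverge_mapF : AllTrajectoriesConverge mapF := by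
  intro x
  by_cases hx : (x : ℝ) = 0
  · have h0 : mapF x = x := Subtype.ext (by rw [coe_mapF, hx]; norm_num)
    refine ⟨x, h0, ?_⟩
    simp_rw [Function.iterate_fixed h0]
    exact tendsto_const_nhds
  · have hpos : 0 < (x : ℝ) := lt_of_le_of_ne x.2.1 (Ne.symm hx)
    obtain ⟨k, hk⟩ := pow_unbounded_of_one_lt (1 / 3 / (x : ℝ)) (by norm_num : (1 : ℝ) < 3)
    obtain ⟨n, hn⟩ := exists_iterate_mapF_ge k x ((div_lt_iff₀ hpos).1 hk).le
    have h0 := mapF_of_two_thirds_le hn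
    refine ⟨_, h0, ?_⟩
    rw [← tendsto_add_atTop_iff_nat n]
    simp_rw [Function.iterate_add_apply, Function.iterate_fixed h0]
    exact tendsto_const_nhds

theorem allTrajectoriesConverge_mapG : AllTrajectoriesConverge mapG := by
  intro x
  obtain ⟨z, hz, hlim⟩ := allTrajectoriesConverge_mapF (unitInterval.symm x)
  refine ⟨unitInterval.symm z, ?_, ?_⟩
  · rw [← unitInterval.symm_inj, ← mapF_symm, unitInterval.symm_symm, hz]
  · have hsemi : Function.Semiconj unitInterval.symm mapG mapF := fun x => (mapF_symm x).symm
    refine ((unitInterval.continuous_symm.tendsto z).comp hlim).congr fun n => ?_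
    rw [Function.comp_apply, ← (hsemi.iterate_right n) x, unitInterval.symm_symm]

/-- The initial error decays like $r^k$, and the forcing error is averaged with total weight at most
$1$. -/
theorem tendsto_of_contracting_recurrence {a b : ℕ → ℝ} {r L : ℝ} (hr0 : 0 ≤ r) (hr1 : r < 1)
    (hab : ∀ n, a (n + 1) = (1 - r) * b n + r * a n) (hb : Tendsto b atTop (𝓝 L)) :
    Tendsto a atTop (𝓝 L) := by
  rw [Metric.tendsto_atTop] at hb ⊢
  intro ε hε
  obtain ⟨N, hN⟩ := hb (ε / 2) (half_pos hε)
  have key : ∀ k, |a (N + k) - L| ≤ r ^ k * |a N - L| + ε / 2 := by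
    intro k
    induction k with
    | zero => simpa using (half_pos hε).le
    | succ k ih =>
      have hbk : |b (N + k) - L| < ε / 2 := by
        simpa [Real.dist_eq] using hN (N + k) (Nat.le_add_right _ _)
      have e : a (N + (k + 1)) - L = (1 - r) * (b (N + k) - L) + r * (a (N + k) - L) := by
        rw [← add_assoc, hab]; ring
      calc |a (N + (k + 1)) - L| ≤ (1 - r) * |b (N + k) - L| + r * |a (N + k) - L| := by
            rw [e]
            refine (abs_add_le _ _).trans_eq ?_
            rw [abs_mul, abs_mul, abs_of_nonneg hr0, abs_of_pos (sub_pos.2 hr1)]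
        _ ≤ (1 - r) * (ε / 2) + r * (r ^ k * |a N - L| + ε / 2) := by
            have := (sub_pos.2 hr1).le
            gcongr
        _ = r ^ (k + 1) * |a N - L| + ε / 2 := by ring
  have h0 : Tendsto (fun k => r ^ k * |a N - L|) atTop (𝓝 0) := by
    simpa using (tendsto_pow_atTop_nhds_zero_of_lt_one hr0 hr1).mul_const |a N - L|
  obtain ⟨M, hM⟩ := eventually_atTop.1 (h0.eventually (gt_mem_nhds (half_pos hε)))
  refine ⟨N + M, fun n hn => ?_⟩
  obtain ⟨k, rfl⟩ := Nat.exists_eq_add_of_le ((Nat.le_add_right N M).trans hn)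
  rw [Real.dist_eq]
  linarith [key k, hM k (by omega)]

/-! ### Expected positions and the Baire argument -/

section Random

variable {p : ℝ}

/-- The expected position after `n` steps. -/
noncomputable def expectedPos (p : ℝ) (n : ℕ) : Icc (0 : ℝ) 1 → ℝ :=
  (choiceOp mapF mapG p)^[n] Subtype.val

theorem expectedPos_succ (p : ℝ) (n : ℕ) (x : Icc (0 : ℝ) 1) : expectedPos p (n + 1) x =
    p * expectedPos p n (mapF x) + (1 - p) * expectedPos p n (mapG x) :=
  choiceOp_iterate_succ _ _ _ _ _ _

theorem tendsto_expectedPos_of_left (hp0 : 0 < p) (hp1 : p < 1) {x z : Icc (0 : ℝ) 1}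
    (hx : (x : ℝ) ≤ 1 / 3) (hz : (z : ℝ) = 3 * x) {L : ℝ}
    (h : Tendsto (fun n => expectedPos p n z) atTop (𝓝 L)) :
    Tendsto (fun n => expectedPos p n x) atTop (𝓝 L) := by
  have hf : mapF x = z := Subtype.ext (by rw [coe_mapF, if_pos hx, hz])
  have hg : mapG x = x := Subtype.ext (by rw [coe_mapG, if_pos hx])
  refine tendsto_of_contracting_recurrence (r := 1 - p) (by linarith) (by linarith)
    (fun n => ?_) h
  rw [expectedPos_succ, hf, hg, sub_sub_cancel]

theorem tendsto_expectedPos_of_right (hp0 : 0 < p) (hp1 : p < 1) {x z : Icc (0 : ℝ) 1}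
    (hx : 2 / 3 ≤ (x : ℝ)) (hz : (z : ℝ) = 3 * x - 2) {L : ℝ}
    (h : Tendsto (fun n => expectedPos p n z) atTop (𝓝 L)) :
    Tendsto (fun n => expectedPos p n x) atTop (𝓝 L) := by
  have hg : mapG x = z :=
    Subtype.ext (by rw [coe_mapG, if_neg (by linarith), if_neg (by linarith), hz])
  refine tendsto_of_contracting_recurrence (r := p) hp0.le hp1 (fun n => ?_) h
  rw [expectedPos_succ, mapF_of_two_thirds_le hx, hg, add_comm]

theorem tendsto_expectedPos_of_middle (hp0 : 0 < p) (hp1 : p < 1) {x z : Icc (0 : ℝ) 1}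
    (h1 : 1 / 3 ≤ (x : ℝ)) (h2 : (x : ℝ) ≤ 2 / 3) (hz : (z : ℝ) = 2 - 3 * x) {L : ℝ}
    (h : Tendsto (fun n => expectedPos p n z) atTop (𝓝 L)) :
    Tendsto (fun n => expectedPos p n x) atTop (𝓝 L) := by
  have hf : (mapF x : ℝ) = -x + 4 / 3 := by rw [coe_mapF]; split_ifs <;> linarith
  have hg : (mapG x : ℝ) = -x + 2 / 3 := by rw [coe_mapG]; split_ifs <;> linarith
  have hf' : Tendsto (fun n => expectedPos p n (mapF x)) atTop (𝓝 L) :=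
    tendsto_expectedPos_of_right hp0 hp1 (by linarith) (by linarith) h
  have hg' : Tendsto (fun n => expectedPos p n (mapG x)) atTop (𝓝 L) :=
    tendsto_expectedPos_of_left hp0 hp1 (by linarith) (by linarith) h
  -- The recurrence gives time $n+1$ at $x$ from time $n$ at its two images.
  rw [← tendsto_add_atTop_iff_nat 1]
  simp_rw [expectedPos_succ]
  convert (hf'.const_mul p).add (hg'.const_mul (1 - p)) using 2
  ring

/-- Each inverse branch of $T$ contracts by $1/3$: approximate $T(x)$, then pull back along the
branch through $x$. -/
theorem exists_near_tendsto_expectedPos (hp0 : 0 < p) (hp1 : p < 1) {c : Icc (0 : ℝ) 1} {L : ℝ}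
    (hc : Tendsto (fun n => expectedPos p n c) atTop (𝓝 L)) (k : ℕ) (x : Icc (0 : ℝ) 1) :
    ∃ z : Icc (0 : ℝ) 1, |(z : ℝ) - x| ≤ (1 / 3) ^ k ∧
      Tendsto (fun n => expectedPos p n z) atTop (𝓝 L) := by
  induction k generalizing x with
  | zero =>
    refine ⟨c, ?_, hc⟩
    rw [pow_zero, abs_le]
    constructor <;> linarith [c.2.1, c.2.2, x.2.1, x.2.2]
  | succ k ih =>
    have mk : ∀ r : ℝ, 0 ≤ r → r ≤ 1 → ∃ u : Icc (0 : ℝ) 1, (u : ℝ) = r :=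
      fun r h0 h1 => ⟨⟨r, h0, h1⟩, rfl⟩
    have hx0 : 0 ≤ (x : ℝ) := x.2.1
    have hx1 : (x : ℝ) ≤ 1 := x.2.2
    rw [pow_succ]
    rcases le_or_gt (x : ℝ) (1 / 3) with h1 | h1
    · obtain ⟨y, hy⟩ := mk (3 * x) (by linarith) (by linarith)
      obtain ⟨w, hw, hlim⟩ := ih y
      have hw0 : 0 ≤ (w : ℝ) := w.2.1
      have hw1 : (w : ℝ) ≤ 1 := w.2.2
      obtain ⟨z, hz⟩ := mk (w / 3) (by linarith) (by linarith)
      rw [abs_le] at hw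
      exact ⟨z, by rw [abs_le]; constructor <;> linarith,
        tendsto_expectedPos_of_left hp0 hp1 (by linarith) (by linarith) hlim⟩
    rcases le_or_gt (x : ℝ) (2 / 3) with h2 | h2
    · obtain ⟨y, hy⟩ := mk (2 - 3 * x) (by linarith) (by linarith)
      obtain ⟨w, hw, hlim⟩ := ih y
      have hw0 : 0 ≤ (w : ℝ) := w.2.1
      have hw1 : (w : ℝ) ≤ 1 := w.2.2
      obtain ⟨z, hz⟩ := mk ((2 - w) / 3) (by linarith) (by linarith)
      rw [abs_le] at hw
      exact ⟨z, by rw [abs_le]; constructor <;> linarith,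
        tendsto_expectedPos_of_middle hp0 hp1 (by linarith) (by linarith) (by linarith) hlim⟩
    · obtain ⟨y, hy⟩ := mk (3 * x - 2) (by linarith) (by linarith)
      obtain ⟨w, hw, hlim⟩ := ih y
      have hw0 : 0 ≤ (w : ℝ) := w.2.1
      have hw1 : (w : ℝ) ≤ 1 := w.2.2
      obtain ⟨z, hz⟩ := mk ((w + 2) / 3) (by linarith) (by linarith)
      rw [abs_le] at hw
      exact ⟨z, by rw [abs_le]; constructor <;> linarith,
        tendsto_expectedPos_of_right hp0 hp1 (by linarith) (by linarith) hlim⟩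

theorem mapF_zero : mapF 0 = 0 := Subtype.ext (by rw [coe_mapF]; norm_num)

theorem mapG_zero : mapG 0 = 0 := Subtype.ext (by rw [coe_mapG]; norm_num)

theorem mapF_one : mapF 1 = 1 := Subtype.ext (by rw [coe_mapF]; norm_num)

theorem mapG_one : mapG 1 = 1 := Subtype.ext (by rw [coe_mapG]; norm_num)

theorem expectedPos_of_fixed {c : Icc (0 : ℝ) 1} (hf : mapF c = c) (hg : mapG c = c) (p : ℝ)
    (n : ℕ) : expectedPos p n c = c := by
  induction n with
  | zero => rfl
  | succ n ih => rw [expectedPos_succ, hf, hg, ih]; ring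

theorem dense_tendsto_expectedPos (hp0 : 0 < p) (hp1 : p < 1) {c : Icc (0 : ℝ) 1}
    (hf : mapF c = c) (hg : mapG c = c) :
    Dense {z : Icc (0 : ℝ) 1 | Tendsto (fun n => expectedPos p n z) atTop (𝓝 (c : ℝ))} := by
  rw [Metric.dense_iff]
  intro x r hr
  obtain ⟨k, hk⟩ := exists_pow_lt_of_lt_one hr (by norm_num : (1 / 3 : ℝ) < 1)
  obtain ⟨z, hz, hlim⟩ := exists_near_tendsto_expectedPos hp0 hp1 (c := c) (L := c)
    (by simp_rw [expectedPos_of_fixed hf hg]; exact tendsto_const_nhds) k x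
  exact ⟨z, by rw [Metric.mem_ball, Subtype.dist_eq, Real.dist_eq]; exact hz.trans_lt hk, hlim⟩

/-- The average over the times `i < n` of the expected position. -/
noncomputable def meanPos (p : ℝ) (n : ℕ) (x : Icc (0 : ℝ) 1) : ℝ :=
  (n : ℝ)⁻¹ * ∑ i ∈ Finset.range n, expectedPos p i x

theorem continuous_meanPos (p : ℝ) (n : ℕ) : Continuous (meanPos p n) :=
  continuous_const.mul (continuous_finsetSum _ fun i _ =>
    continuous_choiceOp_iterate continuous_mapF continuous_mapG p continuous_subtype_val i)

theorem dense_exists_meanPos_mem (hp0 : 0 < p) (hp1 : p < 1) {c : Icc (0 : ℝ) 1}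
    (hf : mapF c = c) (hg : mapG c = c) {U : Set ℝ} (hU : U ∈ 𝓝 (c : ℝ)) (N : ℕ) :
    Dense {x | ∃ n ≥ N, 0 < n ∧ meanPos p n x ∈ U} := by
  refine (dense_tendsto_expectedPos hp0 hp1 hf hg).mono fun z hz => ?_
  obtain ⟨n, ⟨h1, h2⟩, h3⟩ := (((eventually_ge_atTop N).and (eventually_gt_atTop 0)).and
    ((Filter.Tendsto.cesaro hz).eventually hU)).exists
  exact ⟨n, h1, h2, h3⟩

theorem isOpen_exists_meanPos_mem (p : ℝ) {U : Set ℝ} (hU : IsOpen U) (N : ℕ) :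
    IsOpen {x | ∃ n ≥ N, 0 < n ∧ meanPos p n x ∈ U} := by
  simp only [ofPred_exists, ofPred_and]
  exact isOpen_iUnion fun n => isOpen_const.inter
    (isOpen_const.inter (hU.preimage (continuous_meanPos p n)))

theorem exists_oscillating_meanPos (hp0 : 0 < p) (hp1 : p < 1) :
    ∃ x : Icc (0 : ℝ) 1, ∀ ε > 0, (∃ᶠ n in atTop, 0 < n ∧ meanPos p n x < ε) ∧
      ∃ᶠ n in atTop, 0 < n ∧ 1 - ε < meanPos p n x := by
  have hpos (N : ℕ) : (0 : ℝ) < 1 / (N + 1) := Nat.one_div_pos_of_nat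
  have hd0 (N : ℕ) := dense_exists_meanPos_mem hp0 hp1 mapF_zero mapG_zero
    (Iio_mem_nhds (by simpa using hpos N) : Iio (1 / ((N : ℝ) + 1)) ∈ _) N
  have hd1 (N : ℕ) := dense_exists_meanPos_mem hp0 hp1 mapF_one mapG_one
    (Ioi_mem_nhds (by simpa using hpos N) : Ioi (1 - 1 / ((N : ℝ) + 1)) ∈ _) N
  have ho0 (N : ℕ) := isOpen_exists_meanPos_mem p (isOpen_Iio (a := 1 / ((N : ℝ) + 1))) N
  have ho1 (N : ℕ) := isOpen_exists_meanPos_mem p (isOpen_Ioi (a := 1 - 1 / ((N : ℝ) + 1))) N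
  -- The index $N$ controls both the closeness $1/(N+1)$ and the lateness $n\ge N$.
  obtain ⟨x, hx⟩ := (dense_iInter_of_isOpen_nat (fun N => (ho0 N).inter (ho1 N))
    fun N => (hd0 N).inter_of_isOpen_left (hd1 N) (ho0 N)).nonempty
  rw [mem_iInter] at hx
  refine ⟨x, fun ε hε => ?_⟩
  obtain ⟨M, hM⟩ := exists_nat_one_div_lt hε
  have hle (N : ℕ) : 1 / ((max M N : ℕ) + 1 : ℝ) < ε :=
    (Nat.one_div_le_one_div (le_max_left M N)).trans_lt hM
  simp only [frequently_atTop]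
  constructor <;> intro N
  · obtain ⟨n, hn, h0, h⟩ := (hx (max M N)).1
    exact ⟨n, (le_max_right M N).trans hn, h0, (mem_Iio.1 h).trans (hle N)⟩
  · obtain ⟨n, hn, h0, h⟩ := (hx (max M N)).2
    exact ⟨n, (le_max_right M N).trans hn, h0, by linarith [mem_Ioi.1 h, hle N]⟩

end Random

/-! ### Bounds on the distribution functions -/

section DistFun

variable {a b : ℝ}

theorem distFun_nonneg (f g : Icc a b → Icc a b) (p : unitInterval) (x y : Icc a b) (n : ℕ)
    (t : ℝ) : 0 ≤ distFun f g p x y n t :=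
  mul_nonneg (by positivity) (Finset.sum_nonneg fun _ _ => measureReal_nonneg)

theorem distFun_le_one (f g : Icc a b → Icc a b) (p : unitInterval) (x y : Icc a b) (n : ℕ)
    (t : ℝ) : distFun f g p x y n t ≤ 1 := by
  rw [distFun, one_div, ← div_eq_inv_mul]
  refine div_le_one_of_le₀ ?_ n.cast_nonneg
  refine (Finset.sum_le_sum fun i _ => measureReal_le_one).trans ?_
  simp

theorem upperDistFun_le_one (f g : Icc a b → Icc a b) (p : unitInterval) (x y : Icc a b) (t : ℝ) :
    upperDistFun f g p x y t ≤ 1 :=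
  limsup_le_of_le (isCoboundedUnder_le_of_le atTop fun n => distFun_nonneg f g p x y n t)
    (Eventually.of_forall fun n => distFun_le_one f g p x y n t)

theorem lowerDistFun_nonneg (f g : Icc a b → Icc a b) (p : unitInterval) (x y : Icc a b) (t : ℝ) :
    0 ≤ lowerDistFun f g p x y t :=
  le_liminf_of_le (isCoboundedUnder_ge_of_le atTop fun n => distFun_le_one f g p x y n t)
    (Eventually.of_forall fun n => distFun_nonneg f g p x y n t)

theorem lowerDistFun_le_upperDistFun (f g : Icc a b → Icc a b) (p : unitInterval) (x y : Icc a b)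
    (t : ℝ) : lowerDistFun f g p x y t ≤ upperDistFun f g p x y t :=
  liminf_le_limsup
    (isBoundedUnder_of_eventually_le (Eventually.of_forall fun n => distFun_le_one f g p x y n t))
    (isBoundedUnder_of_eventually_ge (Eventually.of_forall fun n => distFun_nonneg f g p x y n t))

/-- A norm bound on the integrand suffices, so its measurability is not needed. -/
theorem integral_upperDistFun_sub_lowerDistFun_le (f g : Icc a b → Icc a b) (p : unitInterval)
    (x y : Icc a b) (hab : a ≤ b) :
    ∫ t in (0 : ℝ)..(b - a), (upperDistFun f g p x y t - lowerDistFun f g p x y t) ≤ b - a := by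
  have h := intervalIntegral.norm_integral_le_of_norm_le_const (a := 0) (b := b - a) (C := 1)
    (f := fun t => upperDistFun f g p x y t - lowerDistFun f g p x y t) fun t _ => by
      rw [Real.norm_of_nonneg (sub_nonneg.2 (lowerDistFun_le_upperDistFun f g p x y t))]
      linarith [upperDistFun_le_one f g p x y t, lowerDistFun_nonneg f g p x y t]
  rw [one_mul, sub_zero, abs_of_nonneg (sub_nonneg.2 hab)] at h
  exact (le_abs_self _).trans h

end DistFun

/-! ### Extremal distribution functions for the pair $(x,0)$ -/

section Extremal

variable {p : unitInterval} {x : Icc (0 : ℝ) 1} {n : ℕ} {t : ℝ}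

open Classical in
theorem distFun_zero_right (p : unitInterval) (x : Icc (0 : ℝ) 1) (n : ℕ) (t : ℝ) :
    distFun mapF mapG p x 0 n t = (n : ℝ)⁻¹ * ∑ i ∈ Finset.range n,
      (choiceOp mapF mapG p)^[i] (fun z => if (z : ℝ) < t then 1 else 0) x := by
  rw [distFun, one_div]
  congr 1
  refine Finset.sum_congr rfl fun i _ => ?_
  refine Eq.trans ?_ (choiceMeasure_real_trajectory mapF mapG p x i {z | (z : ℝ) < t})
  congr 1
  ext ω
  simp only [trajectory_of_fixed mapF_zero mapG_zero, mem_ofPred_eq]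
  rw [Icc.coe_zero, sub_zero, abs_of_nonneg (trajectory mapF mapG ω x i).2.1]

theorem mul_sum_affine_expectedPos (p : ℝ) (x : Icc (0 : ℝ) 1) (hn : 0 < n) (r s : ℝ) :
    (n : ℝ)⁻¹ * ∑ i ∈ Finset.range n, (choiceOp mapF mapG p)^[i] (fun z => r * 1 + s * (z : ℝ)) x =
      r + s * meanPos p n x := by
  have hn' : (n : ℝ) ≠ 0 := by positivity
  simp_rw [choiceOp_iterate_linear mapF mapG p r s (fun _ => 1) Subtype.val,
    choiceOp_iterate_const, Finset.sum_add_distrib, ← Finset.mul_sum, meanPos, expectedPos]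
  simp only [Finset.sum_const, Finset.card_range, nsmul_eq_mul]
  field_simp

/-- Markov's inequality for the distance to `0`. -/
theorem le_distFun_zero_right (hn : 0 < n) (ht : 0 < t) :
    1 - t⁻¹ * meanPos p n x ≤ distFun mapF mapG p x 0 n t := by
  classical
  rw [distFun_zero_right, sub_eq_add_neg, ← neg_mul, ← mul_sum_affine_expectedPos p x hn]
  gcongr
  refine choiceOp_iterate_mono _ _ p.2.1 p.2.2 (fun z => ?_) _ _
  split_ifs with h
  · have := mul_nonneg (inv_pos.2 ht).le z.2.1
    linarith
  · have := (one_le_div ht).2 (not_lt.1 h)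
    rw [div_eq_inv_mul] at this
    linarith

/-- Markov's inequality for the distance to `1`. -/
theorem distFun_zero_right_le (hn : 0 < n) (ht : t < 1) :
    distFun mapF mapG p x 0 n t ≤ (1 - t)⁻¹ * (1 - meanPos p n x) := by
  classical
  have ht' : 0 < 1 - t := sub_pos.2 ht
  rw [distFun_zero_right, mul_one_sub, sub_eq_add_neg, ← neg_mul,
    ← mul_sum_affine_expectedPos p x hn]
  gcongr
  refine choiceOp_iterate_mono _ _ p.2.1 p.2.2 (fun z => ?_) _ _
  rw [mul_one, neg_mul, ← sub_eq_add_neg, ← mul_one_sub, ← div_eq_inv_mul]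
  split_ifs with h
  · rw [one_le_div ht']; linarith
  · exact div_nonneg (sub_nonneg.2 z.2.2) ht'.le

theorem upperDistFun_eq_one
    (hx : ∀ ε > 0, ∃ᶠ n in atTop, 0 < n ∧ meanPos p n x < ε) (ht : 0 < t) :
    upperDistFun mapF mapG p x 0 t = 1 := by
  refine (upperDistFun_le_one _ _ _ _ _ _).antisymm (le_of_forall_pos_sub_le fun ε hε => ?_)
  -- The factor $t$ cancels the $t^{-1}$ in Markov's inequality.
  refine le_limsup_of_frequently_le ((hx (t * ε) (mul_pos ht hε)).mono fun n hn => ?_)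
    (isBoundedUnder_of_eventually_le (Eventually.of_forall fun n => distFun_le_one _ _ p x 0 n t))
  refine le_trans ?_ (le_distFun_zero_right hn.1 ht)
  have := (inv_mul_lt_iff₀ ht).2 hn.2
  linarith

theorem lowerDistFun_eq_zero
    (hx : ∀ ε > 0, ∃ᶠ n in atTop, 0 < n ∧ 1 - ε < meanPos p n x) (ht : t < 1) :
    lowerDistFun mapF mapG p x 0 t = 0 := by
  have ht' : 0 < 1 - t := sub_pos.2 ht
  refine (le_of_forall_pos_le_add fun ε hε => ?_).antisymm (lowerDistFun_nonneg _ _ _ _ _ _)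
  refine liminf_le_of_frequently_le ((hx ((1 - t) * ε) (mul_pos ht' hε)).mono fun n hn => ?_)
    (isBoundedUnder_of_eventually_ge (Eventually.of_forall fun n => distFun_nonneg _ _ p x 0 n t))
  refine (distFun_zero_right_le hn.1 ht).trans ?_
  rw [zero_add, inv_mul_le_iff₀ ht']
  linarith [hn.2]

theorem chaosMeasure_mapF_mapG (hp0 : 0 < p) (hp1 : p < 1) : chaosMeasure mapF mapG p = 1 := by
  have hle (q : Icc (0 : ℝ) 1 × Icc (0 : ℝ) 1) : (1 / ((1 : ℝ) - 0)) *
      ∫ t in (0 : ℝ)..(1 - 0), (upperDistFun mapF mapG p q.1 q.2 t -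
        lowerDistFun mapF mapG p q.1 q.2 t) ≤ 1 := by
    have := integral_upperDistFun_sub_lowerDistFun_le mapF mapG p q.1 q.2 zero_le_one
    simpa using this
  obtain ⟨x, hx⟩ := exists_oscillating_meanPos (p := p) hp0 hp1
  refine (ciSup_le hle).antisymm (le_ciSup_of_le ⟨1, forall_mem_range.2 hle⟩ (x, 0) ?_)
  -- The integrand is identified only on the open interval, since the two evaluations need $t>0$ and
  -- $t<1$.
  rw [sub_zero, one_div_one, one_mul, intervalIntegral.integral_congr_Ioo_of_le zero_le_one
    (g := fun _ => 1) fun t ht => ?_]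
  · simp
  · simp only
    rw [upperDistFun_eq_one (fun ε hε => (hx ε hε).1) ht.1,
      lowerDistFun_eq_zero (fun ε hε => (hx ε hε).2) ht.2, sub_zero]

end Extremal

end RandomChaos

theorem mainTheorem6 :
    (∀ p : unitInterval, 0 < p → p < 1 →
      RandomChaos.chaosMeasure RandomChaos.mapF RandomChaos.mapG p = 1) ∧
    (RandomChaos.AllTrajectoriesConverge RandomChaos.mapF ∧
      ¬ RandomChaos.IsDistributionallyChaotic RandomChaos.mapF) ∧
    (RandomChaos.AllTrajectoriesConverge RandomChaos.mapG ∧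
      ¬ RandomChaos.IsDistributionallyChaotic RandomChaos.mapG) ∧
    RandomChaos.chaosMeasure RandomChaos.mapF RandomChaos.mapG 0 = 0 ∧
    RandomChaos.chaosMeasure RandomChaos.mapF RandomChaos.mapG 1 = 0 :=
  ⟨fun _ => RandomChaos.chaosMeasure_mapF_mapG,
    ⟨RandomChaos.allTrajectoriesConverge_mapF,
      RandomChaos.allTrajectoriesConverge_mapF.not_isDistributionallyChaotic⟩,
    ⟨RandomChaos.allTrajectoriesConverge_mapG,
      RandomChaos.allTrajectoriesConverge_mapG.not_isDistributionallyChaotic⟩,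
    RandomChaos.allTrajectoriesConverge_mapG.chaosMeasure_zero _,
    RandomChaos.allTrajectoriesConverge_mapF.chaosMeasure_one _⟩
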